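/- An adder layer $L:\mathbb{R}^{m}\to\mathbb{R}^{k}$ is a map of the form $L(X)_i = a_i\,\|W_i - X\|_1 + b_i$ for $1\le i\le k$, where $W_i\in\mathbb{R}^{m}$, $a_i, b_i\in\mathbb{R}$ and $\|\cdot\|_1$ is the $\ell_1$-norm; it has $k$ neurons. An AdderNet on $\mathbb{R}^d$ with ReLU activation is a function $A:\mathbb{R}^d\to\mathbb{R}$ of the form $$A(X) = L_n(G(L_{n-1}(\cdots G(L_1(X))\cdots))),\qquad n\ge 1,$$ where $L_1,\dots,L_n$ are adder layers of compatible dimensions, $L_n$ has a single output, and $G(t)=\max(t,0)$ is applied coordinatewise. Its width is the maximum number of neurons in any of its layers $L_1,\dots,L_n$. Theorem (Universal Approximation of Width-Bounded AdderNet). Let $d\in\mathbb{N}$, let $K\subset\mathbb{R}^d$ be compact and let $f\in L^1(K)$ (with respect to Lebesgue measure). For every $\varepsilon>0$ there is an AdderNet $A$ with ReLU activation, of arbitrary finite depth and of width at most $2(d+5)$, such that $f-A$ is integrable on $K$ and $$\int_K |f(X)-A(X)|\,dX \le \varepsilon .$$ -/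

import Mathlib

/-- Parameters of an adder layer `ℝ^m → ℝ^k` (batch normalization absorbed in `scale` and `bias`).
The filter of the `i`-th output channel is the `i`-th column of `weight`. -/
structure AdderLayer (m k : ℕ) where
  weight : Matrix (Fin m) (Fin k) ℝ
  scale : Fin k → ℝ
  bias : Fin k → ℝ

/-- The layer map: `L(X)_i = a_i * ‖W_i - X‖₁ + b_i`. -/
def AdderLayer.eval {m k : ℕ} (L : AdderLayer m k) (x : Fin m → ℝ) : Fin k → ℝ :=
  fun i => L.scale i * (∑ j, |L.weight j i - x j|) + L.bias i

/-- A finite, nonempty sequence of composable adder layers, from the input side to the output side,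
with input dimension `m` and output dimension `k`. -/
inductive AdderNet : ℕ → ℕ → Type
  | single {m k : ℕ} (L : AdderLayer m k) : AdderNet m k
  | cons {m h k : ℕ} (L : AdderLayer m h) (N : AdderNet h k) : AdderNet m k

/-- The function `L_n(G(L_{n-1}(… G(L_1(X)) …)))` computed by the network, where the activation
function `G` acts coordinatewise between consecutive layers (and not after the last one). -/
def AdderNet.eval (G : ℝ → ℝ) : {m k : ℕ} → AdderNet m k → (Fin m → ℝ) → (Fin k → ℝ)
  | _, _, .single L, x => L.eval x
  | _, _, .cons L N, x => N.eval G (fun i => G (L.eval x i))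

/-- The width: the maximum number of neurons (output channels) over all the layers. -/
def AdderNet.width : {m k : ℕ} → AdderNet m k → ℕ
  | _, k, .single _ => k
  | _, _, .cons (h := h) _ N => max h N.width

/-- The rectified linear unit. -/
def relu (t : ℝ) : ℝ := max t 0

/-!
Suppose that every register of a network, with values in `[0, R]`, is stored twice. A neuron
reading the two copies `t, t` with weights `w₁, w₂` receives `|w₁ - t| + |w₂ - t|`, which is `2 t`
for `(0, 0)`, the constant `R` for `(0, R)`, `2 R - 2 t` for `(R, R)`, and, up to a constant, twice
the distance from `t` to `[l, r]` for `(l, r)`. Hence one neuron can copy a register, add or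
subtract two registers, or compute the `ℓ₁`-distance from several registers to a box; applying ReLU
to an affine function of this distance gives a *bump*, equal to `1` on the box and vanishing away
from it. A network that holds the input coordinates, an accumulator and the last bump can therefore
add up any linear combination of bumps, one per layer (`exists_adderNet_bumpSum`); the signs of the
coefficients are realized by adding or subtracting, and biases keep all the registers nonnegative.

The input is not stored twice, so the first layer cannot isolate its coordinates. Instead it
computes `d + 1` signed sums of them (`signedSums`), from which the coordinates can be recovered,
and the boxes are taken in these new coordinates. Altogether `d + 3` doubled registers are used.

Linear combinations of bumps are dense in `L¹` of a finite measure (`BumpApprox.of_integrable`): the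
indicator of a box is a limit of bumps, and boxes form a `π`-system generating the Borel sets, so
the indicators of all measurable sets can be approximated.
-/

/-! ### Bumps on boxes -/

/-- The data of a bump function on `ℝⁿ`: a nonempty box `[lo, hi]` and a nonnegative slope. -/
structure Bump (n : ℕ) where
  lo : Fin n → ℝ
  hi : Fin n → ℝ
  slope : ℝ
  lo_le_hi : lo ≤ hi
  slope_nonneg : 0 ≤ slope

namespace Bump

variable {n : ℕ}

/-- Twice the `ℓ₁`-distance from `y` to the box `[lo, hi]`. -/
def boxDist (B : Bump n) (y : Fin n → ℝ) : ℝ :=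
  ∑ i, (|B.lo i - y i| + |B.hi i - y i| - (B.hi i - B.lo i))

/-- The bump itself: `1` on the box, decreasing linearly to `0` with the `ℓ₁`-distance to the box.
Slope `0` gives the constant function `1`. -/
def toFun (B : Bump n) (y : Fin n → ℝ) : ℝ :=
  relu (1 - B.slope * B.boxDist y)

lemma boxDist_summand_nonneg (B : Bump n) (y : Fin n → ℝ) (i : Fin n) :
    0 ≤ |B.lo i - y i| + |B.hi i - y i| - (B.hi i - B.lo i) := by
  have h1 := neg_abs_le (B.lo i - y i)
  have h2 := le_abs_self (B.hi i - y i)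
  linarith

lemma boxDist_nonneg (B : Bump n) (y : Fin n → ℝ) : 0 ≤ B.boxDist y :=
  Finset.sum_nonneg fun i _ => B.boxDist_summand_nonneg y i

lemma boxDist_eq_zero_iff (B : Bump n) (y : Fin n → ℝ) :
    B.boxDist y = 0 ↔ y ∈ Set.Icc B.lo B.hi := by
  rw [boxDist, Finset.sum_eq_zero_iff_of_nonneg fun i _ => B.boxDist_summand_nonneg y i]
  simp only [Finset.mem_univ, true_implies, Set.mem_Icc, Pi.le_def, ← forall_and]
  refine forall_congr' fun i => ⟨fun h => ?_, fun h => ?_⟩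
  · have h1 := neg_abs_le (B.lo i - y i)
    have h2 := le_abs_self (B.hi i - y i)
    have h3 := le_abs_self (B.lo i - y i)
    have h4 := neg_abs_le (B.hi i - y i)
    have h5 := B.lo_le_hi i
    constructor
    · by_contra! hlt
      linarith [abs_of_pos (sub_pos.2 hlt)]
    · by_contra! hlt
      linarith [abs_of_neg (sub_neg.2 hlt)]
  · rw [abs_of_nonpos (by linarith), abs_of_nonneg (by linarith)]
    ring

lemma toFun_nonneg (B : Bump n) (y : Fin n → ℝ) : 0 ≤ B.toFun y :=
  le_max_right _ _

lemma toFun_le_one (B : Bump n) (y : Fin n → ℝ) : B.toFun y ≤ 1 :=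
  max_le (by linarith [mul_nonneg B.slope_nonneg (B.boxDist_nonneg y)]) zero_le_one

lemma continuous_toFun (B : Bump n) : Continuous B.toFun := by
  unfold toFun boxDist relu
  fun_prop

end Bump

/-- The linear combination of bumps with the coefficients listed in `T`. -/
def bumpSum {n : ℕ} (T : List (ℝ × Bump n)) (y : Fin n → ℝ) : ℝ :=
  (T.map fun t => t.1 * t.2.toFun y).sum

section bumpSum

variable {n : ℕ}

@[simp]
lemma bumpSum_nil (y : Fin n → ℝ) : bumpSum [] y = 0 := rfl

@[simp]
lemma bumpSum_cons (t : ℝ × Bump n) (T : List (ℝ × Bump n)) (y : Fin n → ℝ) :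
    bumpSum (t :: T) y = t.1 * t.2.toFun y + bumpSum T y := by
  simp [bumpSum]

lemma bumpSum_append (T U : List (ℝ × Bump n)) (y : Fin n → ℝ) :
    bumpSum (T ++ U) y = bumpSum T y + bumpSum U y := by
  simp [bumpSum]

lemma bumpSum_scale (c : ℝ) (T : List (ℝ × Bump n)) (y : Fin n → ℝ) :
    bumpSum (T.map fun t => (c * t.1, t.2)) y = c * bumpSum T y := by
  induction T with
  | nil => simp
  | cons t T ih => simp only [List.map_cons, bumpSum_cons, ih]; ring

end bumpSum

/-! ### Density of linear combinations of bumps in `L¹` -/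

section Density

open MeasureTheory Filter Topology

variable {X : Type*} [MeasurableSpace X] {μ : Measure X} {n : ℕ} {p : X → Fin n → ℝ}

/-- `f` lies in the `L¹(μ)`-closure of the linear combinations of bumps in the coordinates `p`. -/
def BumpApprox (μ : Measure X) (p : X → Fin n → ℝ) (f : X → ℝ) : Prop :=
  Integrable f μ ∧ ∀ ε : ℝ, 0 < ε →
    ∃ T : List (ℝ × Bump n), ∫ x, |f x - bumpSum T (p x)| ∂μ ≤ ε

lemma integrable_bumpSum [IsFiniteMeasure μ] (hp : Measurable p) (T : List (ℝ × Bump n)) :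
    Integrable (fun x => bumpSum T (p x)) μ := by
  induction T with
  | nil => simp
  | cons t T ih =>
    simp only [bumpSum_cons]
    refine Integrable.add (Integrable.const_mul ?_ _) ih
    refine Integrable.of_bound (t.2.continuous_toFun.measurable.comp hp).aestronglyMeasurable 1
      (.of_forall fun x => ?_)
    rw [Real.norm_eq_abs, abs_of_nonneg (t.2.toFun_nonneg _)]
    exact t.2.toFun_le_one _

lemma integral_abs_sub_le {f g h : X → ℝ} (hf : Integrable f μ) (hg : Integrable g μ)
    (hh : Integrable h μ) :
    ∫ x, |f x - h x| ∂μ ≤ ∫ x, |f x - g x| ∂μ + ∫ x, |g x - h x| ∂μ := by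
  calc ∫ x, |f x - h x| ∂μ ≤ ∫ x, (|f x - g x| + |g x - h x|) ∂μ :=
        integral_mono (hf.sub hh).abs ((hf.sub hg).abs.add (hg.sub hh).abs)
          fun x => abs_sub_le _ _ _
    _ = _ := integral_add (hf.sub hg).abs (hg.sub hh).abs

namespace BumpApprox

lemma of_approx [IsFiniteMeasure μ] (hp : Measurable p) {f : X → ℝ} (hf : Integrable f μ)
    (h : ∀ ε : ℝ, 0 < ε → ∃ g, BumpApprox μ p g ∧ ∫ x, |f x - g x| ∂μ ≤ ε) :
    BumpApprox μ p f := by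
  refine ⟨hf, fun ε hε => ?_⟩
  obtain ⟨g, hg, hfg⟩ := h (ε / 2) (half_pos hε)
  obtain ⟨T, hT⟩ := hg.2 (ε / 2) (half_pos hε)
  refine ⟨T, (integral_abs_sub_le hf hg.1 (integrable_bumpSum hp T)).trans ?_⟩
  linarith

lemma of_tendsto [IsFiniteMeasure μ] (hp : Measurable p) {f : X → ℝ} {F : ℕ → X → ℝ}
    (hF : ∀ k, BumpApprox μ p (F k)) (hf : Integrable f μ) {C : ℝ}
    (hC : ∀ k x, |f x - F k x| ≤ C) (hlim : ∀ x, Tendsto (fun k => F k x) atTop (𝓝 (f x))) :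
    BumpApprox μ p f := by
  refine of_approx hp hf fun ε hε => ?_
  have key : Tendsto (fun k => ∫ x, |f x - F k x| ∂μ) atTop (𝓝 (∫ _, (0 : ℝ) ∂μ)) := by
    refine tendsto_integral_of_dominated_convergence (fun _ => C)
      (fun k => (hf.sub (hF k).1).abs.aestronglyMeasurable) (integrable_const C)
      (fun k => .of_forall fun x => ?_) (.of_forall fun x => ?_)
    · rw [Real.norm_eq_abs, abs_abs]
      exact hC k x
    · simpa using ((hlim x).const_sub (f x)).abs
  rw [integral_zero] at key
  obtain ⟨k, hk⟩ := (key.eventually_le_const hε).exists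
  exact ⟨F k, hF k, hk⟩

lemma bump [IsFiniteMeasure μ] (hp : Measurable p) (B : Bump n) :
    BumpApprox μ p fun x => B.toFun (p x) := by
  have h : (fun x => B.toFun (p x)) = fun x => bumpSum [(1, B)] (p x) := by simp
  refine ⟨h ▸ integrable_bumpSum hp _, fun ε hε => ⟨[(1, B)], ?_⟩⟩
  simpa using hε.le

lemma add [IsFiniteMeasure μ] (hp : Measurable p) {f g : X → ℝ}
    (hf : BumpApprox μ p f) (hg : BumpApprox μ p g) :
    BumpApprox μ p fun x => f x + g x := by
  refine ⟨hf.1.add hg.1, fun ε hε => ?_⟩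
  obtain ⟨T, hT⟩ := hf.2 (ε / 2) (half_pos hε)
  obtain ⟨U, hU⟩ := hg.2 (ε / 2) (half_pos hε)
  refine ⟨T ++ U, ?_⟩
  have hiT := (hf.1.sub (integrable_bumpSum hp T)).abs
  have hiU := (hg.1.sub (integrable_bumpSum hp U)).abs
  calc ∫ x, |f x + g x - bumpSum (T ++ U) (p x)| ∂μ
      ≤ ∫ x, (|f x - bumpSum T (p x)| + |g x - bumpSum U (p x)|) ∂μ := by
        refine integral_mono ((hf.1.add hg.1).sub (integrable_bumpSum hp _)).abs
          (hiT.add hiU) fun x => ?_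
        simp only [bumpSum_append, add_sub_add_comm]
        exact abs_add_le _ _
    _ = ∫ x, |f x - bumpSum T (p x)| ∂μ + ∫ x, |g x - bumpSum U (p x)| ∂μ :=
        integral_add hiT hiU
    _ ≤ ε := by linarith

lemma const_mul {f : X → ℝ} (hf : BumpApprox μ p f) (c : ℝ) :
    BumpApprox μ p fun x => c * f x := by
  refine ⟨hf.1.const_mul c, fun ε hε => ?_⟩
  obtain ⟨T, hT⟩ := hf.2 (ε / (|c| + 1)) (by positivity)
  refine ⟨T.map fun t => (c * t.1, t.2), ?_⟩
  simp only [bumpSum_scale, ← mul_sub, abs_mul, integral_const_mul]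
  calc |c| * ∫ x, |f x - bumpSum T (p x)| ∂μ ≤ |c| * (ε / (|c| + 1)) := by gcongr
    _ ≤ (|c| + 1) * (ε / (|c| + 1)) := by gcongr; linarith
    _ = ε := by field_simp

lemma one [IsFiniteMeasure μ] (hp : Measurable p) : BumpApprox μ p fun _ => 1 := by
  simpa [Bump.toFun, relu] using
    bump (μ := μ) hp (⟨0, 0, 0, le_rfl, le_rfl⟩ : Bump n)

lemma zero : BumpApprox μ p fun _ => 0 :=
  ⟨integrable_zero _ _ _, fun ε hε => ⟨[], by simpa using hε.le⟩⟩

/-- As the slope tends to infinity, bumps converge pointwise to the indicator of their box. -/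
lemma indicator_box [IsFiniteMeasure μ] (hp : Measurable p) {a b : Fin n → ℝ} (hab : a ≤ b) :
    BumpApprox μ p ((p ⁻¹' Set.Icc a b).indicator fun _ => 1) := by
  have hm : MeasurableSet (p ⁻¹' Set.Icc a b) := hp measurableSet_Icc
  let B (k : ℕ) : Bump n := ⟨a, b, k, hab, k.cast_nonneg⟩
  refine of_tendsto (F := fun k x => (B k).toFun (p x)) (C := 1) hp (fun k => bump hp (B k))
    ((integrable_const 1).indicator hm) (fun k x => ?_) fun x => ?_
  · have h0 := (B k).toFun_nonneg (p x)
    have h1 := (B k).toFun_le_one (p x)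
    by_cases hx : x ∈ p ⁻¹' Set.Icc a b
    · rw [Set.indicator_of_mem hx, abs_le]; constructor <;> linarith
    · rw [Set.indicator_of_notMem hx, abs_le]; constructor <;> linarith
  · have hd (k : ℕ) : (B k).boxDist (p x) = (B 0).boxDist (p x) := rfl
    by_cases hx : x ∈ p ⁻¹' Set.Icc a b
    · have h0 : (B 0).boxDist (p x) = 0 := ((B 0).boxDist_eq_zero_iff _).2 hx
      simp [Set.indicator_of_mem hx, Bump.toFun, hd, h0, relu]
    · have h0 : 0 < (B 0).boxDist (p x) :=
        ((B 0).boxDist_nonneg _).lt_of_ne' fun h => hx (((B 0).boxDist_eq_zero_iff _).1 h)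
      rw [Set.indicator_of_notMem hx]
      refine tendsto_const_nhds.congr' ?_
      obtain ⟨k₀, hk₀⟩ := exists_nat_ge (1 / (B 0).boxDist (p x))
      filter_upwards [eventually_ge_atTop k₀] with k hk
      rw [Bump.toFun, relu, hd, eq_comm, max_eq_right]
      have h1 : 1 / (B 0).boxDist (p x) ≤ k := hk₀.trans (by exact_mod_cast hk)
      rw [div_le_iff₀ h0] at h1
      exact sub_nonpos.2 h1

end BumpApprox

/-- The closed boxes of `ℝⁿ`, as products of nonempty closed intervals. -/
def boxes (n : ℕ) : Set (Set (Fin n → ℝ)) :=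
  Set.pi Set.univ '' Set.pi Set.univ fun _ => {S | ∃ i j : ℝ, i ≤ j ∧ Set.Icc i j = S}

lemma isPiSystem_boxes (n : ℕ) : IsPiSystem (boxes n) :=
  IsPiSystem.pi fun _ => isPiSystem_Icc id id

lemma exists_eq_Icc_of_mem_boxes {s : Set (Fin n → ℝ)} (hs : s ∈ boxes n) :
    ∃ a b, a ≤ b ∧ s = Set.Icc a b := by
  obtain ⟨t, ht, rfl⟩ := hs
  choose a b hab ht using fun i => ht i (Set.mem_univ i)
  refine ⟨a, b, hab, ?_⟩
  rw [← Set.pi_univ_Icc]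
  simp only [ht]

lemma generateFrom_Icc_real :
    MeasurableSpace.generateFrom {S | ∃ i j : ℝ, i ≤ j ∧ Set.Icc i j = S} = borel ℝ := by
  apply le_antisymm
  · refine MeasurableSpace.generateFrom_le ?_
    rintro _ ⟨i, j, -, rfl⟩
    rw [← BorelSpace.measurable_eq (α := ℝ)]
    exact measurableSet_Icc
  · rw [borel_eq_generateFrom_Ici ℝ]
    refine MeasurableSpace.generateFrom_le ?_
    rintro _ ⟨a, rfl⟩
    have : Set.Ici a = ⋃ k : ℕ, Set.Icc a (a + k) := by
      ext x
      simp only [Set.mem_Ici, Set.mem_iUnion, Set.mem_Icc, exists_and_left]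
      refine ⟨fun h => ⟨h, ?_⟩, fun h => h.1⟩
      obtain ⟨k, hk⟩ := exists_nat_ge (x - a)
      exact ⟨k, by linarith⟩
    rw [this]
    let _ := MeasurableSpace.generateFrom {S | ∃ i j : ℝ, i ≤ j ∧ Set.Icc i j = S}
    refine MeasurableSet.iUnion fun k => MeasurableSpace.measurableSet_generateFrom ?_
    exact ⟨a, a + k, by simp, rfl⟩

lemma generateFrom_boxes (n : ℕ) : MeasurableSpace.generateFrom (boxes n) = MeasurableSpace.pi := by
  refine generateFrom_eq_pi (fun _ => ?_) fun _ => ?_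
  · rw [generateFrom_Icc_real, BorelSpace.measurable_eq (α := ℝ)]
  · refine ⟨fun k => Set.Icc (-k) k, fun k => ⟨-k, k, by simp, rfl⟩, ?_⟩
    refine Set.eq_univ_of_forall fun x => ?_
    obtain ⟨k, hk⟩ := exists_nat_ge |x|
    exact Set.mem_iUnion.2 ⟨k, abs_le.1 hk⟩

namespace BumpApprox

/-- The sets whose indicators are approximable contain the `π`-system of preimages of boxes and form
a Dynkin system, hence they are all the measurable sets. -/
lemma indicator [IsFiniteMeasure μ] (hp : Measurable p)
    (hgen : ‹MeasurableSpace X› = MeasurableSpace.comap p MeasurableSpace.pi) {s : Set X}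
    (hs : MeasurableSet s) : BumpApprox μ p (s.indicator fun _ => 1) := by
  have hgen' : ‹MeasurableSpace X› = .generateFrom {s | ∃ t ∈ boxes n, p ⁻¹' t = s} := by
    conv_lhs => rw [hgen, ← generateFrom_boxes, MeasurableSpace.comap_generateFrom]
    rfl
  induction s, hs using MeasurableSpace.induction_on_inter hgen'
      ((isPiSystem_boxes n).comap p) with
  | empty => simpa using zero
  | basic t ht =>
    obtain ⟨u, hu, rfl⟩ := ht
    obtain ⟨a, b, hab, rfl⟩ := exists_eq_Icc_of_mem_boxes hu
    exact indicator_box hp hab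
  | compl t ht ih =>
    convert (one hp).add hp (ih.const_mul (-1)) using 2 with x
    by_cases hx : x ∈ t <;> simp [hx]
  | iUnion s hd hm ih =>
    have hfin (k : ℕ) : BumpApprox μ p ((⋃ i < k, s i).indicator fun _ => 1) := by
      induction k with
      | zero => simpa using zero
      | succ k ihk =>
        convert ihk.add hp (ih k) using 2 with x
        rw [Set.biUnion_lt_succ, Set.indicator_union_of_disjoint]
        rw [Set.disjoint_iUnion₂_left]
        exact fun i hi => hd hi.ne
    refine of_tendsto (C := 1) hp hfin
      ((integrable_const 1).indicator (MeasurableSet.iUnion hm)) (fun k x => ?_) fun x => ?_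
    · by_cases hx : x ∈ ⋃ i, s i <;> by_cases hx' : x ∈ ⋃ i < k, s i <;> simp [hx, hx']
    · by_cases hx : x ∈ ⋃ i, s i
      · obtain ⟨i, hi⟩ := Set.mem_iUnion.1 hx
        rw [Set.indicator_of_mem hx]
        refine tendsto_const_nhds.congr' ?_
        filter_upwards [eventually_gt_atTop i] with k hk
        rw [Set.indicator_of_mem (Set.mem_iUnion₂.2 ⟨i, hk, hi⟩)]
      · rw [Set.indicator_of_notMem hx]
        refine tendsto_const_nhds.congr fun k => ?_
        rw [Set.indicator_of_notMem]
        exact fun h => hx (Set.iUnion₂_subset_iUnion _ _ h)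

/-- Every integrable function can be approximated, if the coordinates `p` determine the
`σ`-algebra. -/
theorem of_integrable [IsFiniteMeasure μ] (hp : Measurable p)
    (hgen : ‹MeasurableSpace X› = MeasurableSpace.comap p MeasurableSpace.pi) {f : X → ℝ}
    (hf : Integrable f μ) : BumpApprox μ p f := by
  refine Integrable.induction (BumpApprox μ p) (fun c s hs _ => ?_)
    (fun f g _ _ _ hf hg => hf.add hp hg) ?_ (fun f g hfg _ hf => ?_) hf
  · convert (indicator (μ := μ) hp hgen hs).const_mul c using 2 with x
    by_cases hx : x ∈ s <;> simp [hx]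
  · refine isClosed_of_closure_subset fun f hf => ?_
    refine of_approx hp (L1.integrable_coeFn f) fun ε hε => ?_
    obtain ⟨g, hg, hfg⟩ := Metric.mem_closure_iff.1 hf ε hε
    refine ⟨g, hg, ?_⟩
    rw [L1.dist_eq_integral_dist] at hfg
    simpa only [Real.dist_eq] using hfg.le
  · refine ⟨hf.1.congr hfg, fun ε hε => ?_⟩
    obtain ⟨T, hT⟩ := hf.2 ε hε
    refine ⟨T, (integral_congr_ae ?_).trans_le hT⟩
    filter_upwards [hfg] with x hx
    rw [hx]

end BumpApprox

end Density

/-! ### Neurons reading doubled registers -/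

/-- The function `F` of `m` registers with values in `[0, R]` is computed by a single neuron that
receives each register twice. -/
def Readable {m : ℕ} (R : ℝ) (F : (Fin m → ℝ) → ℝ) : Prop :=
  ∃ (w₁ w₂ : Fin m → ℝ) (a b : ℝ), ∀ v : Fin m → ℝ, (∀ j, v j ∈ Set.Icc 0 R) →
    a * (∑ j, |w₁ j - v j| + ∑ j, |w₂ j - v j|) + b = F v

/-- The functions of one register that a neuron may receive as a summand, up to a constant, when the
register is stored twice. -/
def ReadableTerm (R : ℝ) (h : ℝ → ℝ) : Prop :=
  ∃ w₁ w₂ c : ℝ, ∀ t ∈ Set.Icc 0 R, |w₁ - t| + |w₂ - t| + c = h t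

lemma Readable.of_terms {m : ℕ} {R : ℝ} {h : Fin m → ℝ → ℝ} (hh : ∀ j, ReadableTerm R (h j))
    (a b : ℝ) : Readable R fun v => a * ∑ j, h j (v j) + b := by
  choose w₁ w₂ c hw using hh
  refine ⟨w₁, w₂, a, a * ∑ j, c j + b, fun v hv => ?_⟩
  beta_reduce
  rw [← Finset.sum_congr rfl fun j _ => hw j (v j) (hv j), Finset.sum_add_distrib,
    Finset.sum_add_distrib]
  ring

lemma readableTerm_abs (R l r : ℝ) :
    ReadableTerm R fun t => |l - t| + |r - t| - (r - l) :=
  ⟨l, r, -(r - l), fun t _ => by ring⟩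

/-- The two copies of a register cancel when they are read from opposite ends of `[0, R]`. -/
lemma readableTerm_zero (R : ℝ) : ReadableTerm R fun _ => 0 :=
  ⟨0, R, -R, fun t ht => by
    rw [abs_of_nonpos (by linarith [ht.1]), abs_of_nonneg (by linarith [ht.2])]; ring⟩

lemma readableTerm_two_mul (R : ℝ) : ReadableTerm R fun t => 2 * t :=
  ⟨0, 0, 0, fun t ht => by rw [abs_of_nonpos (by linarith [ht.1])]; ring⟩

lemma readableTerm_neg_two_mul (R : ℝ) : ReadableTerm R fun t => -(2 * t) :=
  ⟨R, R, -(2 * R), fun t ht => by rw [abs_of_nonneg (by linarith [ht.2])]; ring⟩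

lemma Readable.register {m : ℕ} (R : ℝ) (i : Fin m) : Readable R fun v => v i := by
  have h (j : Fin m) : ReadableTerm R fun t => if j = i then 2 * t else 0 := by
    split_ifs
    exacts [readableTerm_two_mul R, readableTerm_zero R]
  convert Readable.of_terms h (1 / 2) 0 using 2 with v
  simp

/-- A layer whose neurons read doubled registers. -/
lemma exists_adderLayer_of_readable {m k : ℕ} {R : ℝ} {F : Fin k → (Fin m → ℝ) → ℝ}
    (hF : ∀ i, Readable R (F i)) :
    ∃ L : AdderLayer (m + m) k, ∀ v : Fin m → ℝ, (∀ j, v j ∈ Set.Icc 0 R) →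
      L.eval (Fin.append v v) = fun i => F i v := by
  choose w₁ w₂ a b h using hF
  refine ⟨⟨fun j i => Fin.append (w₁ i) (w₂ i) j, a, b⟩, fun v hv => funext fun i => ?_⟩
  simp only [AdderLayer.eval, Fin.sum_univ_add, Fin.append_left, Fin.append_right]
  exact h i v hv

/-! ### The accumulating network

The registers are the accumulator (index `0`), the absolute value of the summand to be added next
(index `1`), and `n` coordinates (index `i + 2`). -/

section Accumulator

variable {n : ℕ}

lemma Readable.accumulate (R : ℝ) {σ : ℝ} (hσ : σ = 1 ∨ σ = -1) (κ : ℝ) :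
    Readable (m := n + 2) R fun v => v 0 + σ * v 1 + κ := by
  have h (j : Fin (n + 2)) : ReadableTerm R
      (Fin.cons (α := fun _ => ℝ → ℝ) (fun t => 2 * t)
        (Fin.cons (fun t => σ * (2 * t)) fun _ _ => 0) j) := by
    induction j using Fin.cases with
    | zero => exact readableTerm_two_mul R
    | succ j =>
      induction j using Fin.cases with
      | zero =>
        rcases hσ with rfl | rfl
        · simpa using readableTerm_two_mul R
        · simpa using readableTerm_neg_two_mul R
      | succ j => simpa using readableTerm_zero R
  convert Readable.of_terms h (1 / 2) κ using 2 with v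
  simp [Fin.sum_univ_succ]
  ring

/-- Before activation, a bump is computed by one neuron: the `ℓ₁`-distance to a box is a sum of
absolute values. -/
lemma Readable.bump (R c : ℝ) (B : Bump n) :
    Readable (m := n + 2) R fun v => c * (1 - B.slope * B.boxDist fun i => v i.succ.succ) := by
  have h (j : Fin (n + 2)) : ReadableTerm R
      (Fin.cons (α := fun _ => ℝ → ℝ) (fun _ => 0)
        (Fin.cons (fun _ => 0)
          fun i t => |B.lo i - t| + |B.hi i - t| - (B.hi i - B.lo i)) j) := by
    induction j using Fin.cases with
    | zero => simpa using readableTerm_zero R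
    | succ j =>
      induction j using Fin.cases with
      | zero => simpa using readableTerm_zero R
      | succ j => simpa using readableTerm_abs R (B.lo j) (B.hi j)
  convert Readable.of_terms h (-(c * B.slope)) c using 2 with v
  simp only [Bump.boxDist, Fin.sum_univ_succ (n := n + 1), Fin.sum_univ_succ (n := n),
    Fin.cons_zero, Fin.cons_succ]
  ring

lemma append_self_comp {α β : Type*} {m : ℕ} (g : α → β) (u : Fin m → α) :
    (fun i => g (Fin.append u u i)) = Fin.append (fun i => g (u i)) fun i => g (u i) := by
  funext i
  induction i using Fin.addCases <;> simp only [Fin.append_left, Fin.append_right]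

lemma relu_mul_of_nonneg {c : ℝ} (hc : 0 ≤ c) (t : ℝ) : relu (c * t) = c * relu t := by
  simp [relu, mul_max_of_nonneg _ _ hc]

lemma relu_of_nonneg {t : ℝ} (ht : 0 ≤ t) : relu t = t := max_eq_left ht

/-- The network adds the pending summand, with sign `σ`, to the accumulator, and then the bumps of
`T` one at a time, one layer for each. The sign of a summand is remembered by the architecture, as
registers hold only nonnegative numbers. -/
lemma exists_adderNet_bumpSum (T : List (ℝ × Bump n)) (R : ℝ) {σ : ℝ} (hσ : σ = 1 ∨ σ = -1)
    (κ : ℝ) :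
    ∃ N : AdderNet ((n + 2) + (n + 2)) 1, N.width ≤ 2 * (n + 2) ∧
      ∀ v : Fin (n + 2) → ℝ, (∀ j, v j ∈ Set.Icc 0 R) →
        N.eval relu (Fin.append v v) 0 =
          v 0 + σ * v 1 + κ + bumpSum T fun i => v i.succ.succ := by
  induction T generalizing R σ κ with
  | nil =>
    obtain ⟨L, hL⟩ := exists_adderLayer_of_readable (k := 1) (F := fun _ v => v 0 + σ * v 1 + κ)
      fun _ => Readable.accumulate (n := n) R hσ κ
    refine ⟨.single L, ?_, fun v hv => ?_⟩
    · simp only [AdderNet.width]; omega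
    · simp [AdderNet.eval, hL v hv]
  | cons t T ih =>
    obtain ⟨c, B⟩ := t
    -- The bias `R` keeps the accumulator nonnegative; the constant `κ` is corrected for it.
    obtain ⟨N, hNw, hN⟩ := ih (3 * R + |c|) (σ := if 0 ≤ c then 1 else -1)
      (by split_ifs <;> simp) (κ - R)
    let F : Fin (n + 2) → (Fin (n + 2) → ℝ) → ℝ :=
      Fin.cons (fun v => v 0 + σ * v 1 + R)
        (Fin.cons (fun v => |c| * (1 - B.slope * B.boxDist fun i => v i.succ.succ))
          fun i v => v i.succ.succ)
    have hF (i) : Readable R (F i) := by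
      induction i using Fin.cases with
      | zero => exact Readable.accumulate R hσ R
      | succ i =>
        induction i using Fin.cases with
        | zero => exact Readable.bump R |c| B
        | succ i => exact Readable.register R i.succ.succ
    obtain ⟨L, hL⟩ := exists_adderLayer_of_readable (F := Fin.append F F) (R := R) fun i => by
      induction i using Fin.addCases <;>
        simpa only [Fin.append_left, Fin.append_right] using hF _
    refine ⟨.cons L N, ?_, fun v hv => ?_⟩
    · simp only [AdderNet.width]; omega
    · have hR : 0 ≤ R := (hv 0).1.trans (hv 0).2
      have hc := abs_nonneg c
      let y : Fin n → ℝ := fun i => v i.succ.succ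
      let u : Fin (n + 2) → ℝ :=
        Fin.cons (v 0 + σ * v 1 + R) (Fin.cons (|c| * B.toFun y) y)
      have hσv : v 0 + σ * v 1 + R ∈ Set.Icc 0 (3 * R) := by
        have h0 := hv 0
        have h1 := hv 1
        rcases hσ with rfl | rfl <;> constructor <;> linarith [h0.1, h0.2, h1.1, h1.2]
      have hlayer : (fun i => relu (L.eval (Fin.append v v) i)) = Fin.append u u := by
        rw [hL v hv]
        have : (fun i => relu (F i v)) = u := by
          funext i
          induction i using Fin.cases with
          | zero => exact relu_of_nonneg hσv.1
          | succ i =>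
            induction i using Fin.cases with
            | zero => exact relu_mul_of_nonneg hc _
            | succ i => exact relu_of_nonneg (hv _).1
        rw [append_self_comp (fun G => relu (G v)) F, this]
      have hu (j) : u j ∈ Set.Icc 0 (3 * R + |c|) := by
        induction j using Fin.cases with
        | zero => exact ⟨hσv.1, hσv.2.trans (by linarith)⟩
        | succ j =>
          induction j using Fin.cases with
          | zero =>
            refine ⟨mul_nonneg hc (B.toFun_nonneg y), ?_⟩
            have := mul_le_mul_of_nonneg_left (B.toFun_le_one y) hc
            change |c| * B.toFun y ≤ _
            linarith
          | succ j => exact ⟨(hv _).1, (hv j.succ.succ).2.trans (by linarith)⟩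
      have hsign : (if 0 ≤ c then (1 : ℝ) else -1) * |c| = c := by
        split_ifs with h
        · rw [abs_of_nonneg h, one_mul]
        · rw [abs_of_neg (not_le.1 h)]; ring
      change N.eval relu (fun i => relu (L.eval (Fin.append v v) i)) 0 = _
      rw [hlayer, hN u hu, bumpSum_cons]
      change v 0 + σ * v 1 + R + _ * (|c| * B.toFun y) + (κ - R) + bumpSum T y
        = v 0 + σ * v 1 + κ + (c * B.toFun y + bumpSum T y)
      rw [← mul_assoc, hsign]
      ring

end Accumulator

/-! ### Coordinates computed by the first layer -/

section SignedSums

variable {d : ℕ}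

/-- The `i`-th entry is the `ℓ₁`-distance from `x ∈ [-R, R]ᵈ` to the vertex of this cube whose first
`i` coordinates are `-R` and whose other coordinates are `R`, extended to all `x` as an affine
function. -/
def signedSums (R : ℝ) (x : Fin d → ℝ) : Fin (d + 1) → ℝ :=
  fun i => ∑ j : Fin d, if j.castSucc < i then R + x j else R - x j

lemma continuous_signedSums (R : ℝ) : Continuous (signedSums (d := d) R) := by
  refine continuous_pi fun i => continuous_finsetSum _ fun j _ => ?_
  split_ifs <;> fun_prop

lemma signedSums_succ_sub_castSucc (R : ℝ) (x : Fin d → ℝ) (j : Fin d) :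
    signedSums R x j.succ - signedSums R x j.castSucc = 2 * x j := by
  simp only [signedSums, ← Finset.sum_sub_distrib]
  rw [Finset.sum_eq_single j]
  · simp; ring
  · intro i _ hij
    have : i.castSucc < j.succ ↔ i.castSucc < j.castSucc := by
      simp only [Fin.lt_def, Fin.val_castSucc, Fin.val_succ]
      have := Fin.val_ne_of_ne hij
      omega
    simp [this]
  · simp

lemma comap_signedSums (R : ℝ) :
    (MeasurableSpace.pi : MeasurableSpace (Fin d → ℝ)) =
      MeasurableSpace.comap (signedSums R) MeasurableSpace.pi := by
  refine le_antisymm ?_ (continuous_signedSums R).measurable.comap_le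
  have hinv : Measurable fun (y : Fin (d + 1) → ℝ) (j : Fin d) =>
      (y j.succ - y j.castSucc) / 2 := by fun_prop
  have hid : (fun (y : Fin (d + 1) → ℝ) (j : Fin d) => (y j.succ - y j.castSucc) / 2) ∘
      signedSums R = id := by
    funext x j
    simp [signedSums_succ_sub_castSucc]
  calc (MeasurableSpace.pi : MeasurableSpace (Fin d → ℝ))
      = MeasurableSpace.comap id MeasurableSpace.pi := MeasurableSpace.comap_id.symm
    _ ≤ _ := by
      rw [← hid, ← MeasurableSpace.comap_comp]
      exact MeasurableSpace.comap_mono hinv.comap_le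

lemma sum_abs_eq_signedSums {R : ℝ} {x : Fin d → ℝ} (hx : ∀ j, |x j| ≤ R) (i : Fin (d + 1)) :
    ∑ j : Fin d, |(if j.castSucc < i then -R else R) - x j| = signedSums R x i := by
  refine Finset.sum_congr rfl fun j _ => ?_
  have := abs_le.1 (hx j)
  split_ifs
  · rw [abs_of_nonpos (by linarith)]; ring
  · rw [abs_of_nonneg (by linarith)]

/-- A layer that initializes the registers: accumulator and pending summand are `0`. -/
lemma exists_adderLayer_signedSums (R : ℝ) :
    ∃ L : AdderLayer d ((d + 1 + 2) + (d + 1 + 2)), ∀ x : Fin d → ℝ, (∀ j, |x j| ≤ R) →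
      L.eval x = Fin.append (Fin.cons 0 (Fin.cons 0 (signedSums R x)))
        (Fin.cons 0 (Fin.cons 0 (signedSums R x))) := by
  let w (j : Fin d) (i : Fin (d + 1)) : ℝ := if j.castSucc < i then -R else R
  let W (j : Fin d) : Fin (d + 1 + 2) → ℝ := Fin.cons 0 (Fin.cons 0 (w j))
  let a : Fin (d + 1 + 2) → ℝ := Fin.cons 0 (Fin.cons 0 fun _ => 1)
  refine ⟨⟨fun j => Fin.append (W j) (W j), Fin.append a a, 0⟩, fun x hx => ?_⟩
  have key (i : Fin (d + 1 + 2)) : a i * ∑ j, |W j i - x j| =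
      (Fin.cons 0 (Fin.cons 0 (signedSums R x)) : Fin (d + 1 + 2) → ℝ) i := by
    induction i using Fin.cases with
    | zero => simp [a]
    | succ i =>
      induction i using Fin.cases with
      | zero => simp [a]
      | succ i => simpa [a, W, w] using sum_abs_eq_signedSums hx i
  funext i
  induction i using Fin.addCases with
  | left i => simpa only [AdderLayer.eval, Fin.append_left, Pi.zero_apply, add_zero] using key i
  | right i => simpa only [AdderLayer.eval, Fin.append_right, Pi.zero_apply, add_zero] using key i

lemma signedSums_mem_Icc {R : ℝ} {x : Fin d → ℝ} (hx : ∀ j, |x j| ≤ R) (i : Fin (d + 1)) :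
    signedSums R x i ∈ Set.Icc 0 (d * (2 * R)) := by
  have h (j : Fin d) : (if j.castSucc < i then R + x j else R - x j) ∈ Set.Icc 0 (2 * R) := by
    have := abs_le.1 (hx j)
    split_ifs <;> constructor <;> linarith
  refine ⟨Finset.sum_nonneg fun j _ => (h j).1, ?_⟩
  simpa [signedSums] using Finset.sum_le_card_nsmul Finset.univ _ (2 * R) fun j _ => (h j).2

/-- Linear combinations of bumps in the signed sums are computed exactly on a cube. -/
lemma exists_adderNet_bumpSum_signedSums (R : ℝ) (T : List (ℝ × Bump (d + 1))) :
    ∃ A : AdderNet d 1, A.width ≤ 2 * (d + 3) ∧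
      ∀ x : Fin d → ℝ, (∀ j, |x j| ≤ R) → A.eval relu x 0 = bumpSum T (signedSums R x) := by
  obtain ⟨L, hL⟩ := exists_adderLayer_signedSums (d := d) R
  obtain ⟨N, hNw, hN⟩ := exists_adderNet_bumpSum T (d * (2 * R)) (σ := 1) (.inl rfl) 0
  refine ⟨.cons L N, ?_, fun x hx => ?_⟩
  · simp only [AdderNet.width]; omega
  · let u : Fin (d + 1 + 2) → ℝ := Fin.cons 0 (Fin.cons 0 (signedSums R x))
    have hsum := signedSums_mem_Icc hx
    have hu (j) : u j ∈ Set.Icc 0 (d * (2 * R)) := by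
      have h0 : (0 : ℝ) ∈ Set.Icc 0 (d * (2 * R)) := ⟨le_rfl, (hsum 0).1.trans (hsum 0).2⟩
      induction j using Fin.cases with
      | zero => exact h0
      | succ j =>
        induction j using Fin.cases with
        | zero => exact h0
        | succ j => exact hsum j
    have hlayer : (fun i => relu (L.eval x i)) = Fin.append u u := by
      rw [hL x hx, append_self_comp]
      simp only [relu_of_nonneg (hu _).1, u]
    change N.eval relu (fun i => relu (L.eval x i)) 0 = _
    rw [hlayer, hN u hu]
    simp [u]

end SignedSums

theorem mainTheorem2 (d : ℕ) (K : Set (Fin d → ℝ)) (hK : IsCompact K)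
    (f : (Fin d → ℝ) → ℝ) (hf : MeasureTheory.IntegrableOn f K MeasureTheory.volume)
    (ε : ℝ) (hε : 0 < ε) :
    ∃ A : AdderNet d 1, A.width ≤ 2 * (d + 5) ∧
      MeasureTheory.IntegrableOn (fun x => f x - A.eval relu x 0) K MeasureTheory.volume ∧
      ∫ x in K, |f x - A.eval relu x 0| ≤ ε := by
  obtain ⟨R, hR⟩ := hK.isBounded.exists_norm_le
  have hKR (x) (hx : x ∈ K) (j : Fin d) : |x j| ≤ R := (norm_le_pi_norm x j).trans (hR x hx)
  have : MeasureTheory.IsFiniteMeasure (MeasureTheory.volume.restrict K) :=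
    ⟨by simpa using hK.measure_lt_top⟩
  have hp : Measurable (signedSums (d := d) R) := (continuous_signedSums R).measurable
  obtain ⟨T, hT⟩ := (BumpApprox.of_integrable hp (comap_signedSums R) hf).2 ε hε
  obtain ⟨A, hAw, hA⟩ := exists_adderNet_bumpSum_signedSums R T
  have heq : Set.EqOn (fun x => f x - bumpSum T (signedSums R x))
      (fun x => f x - A.eval relu x 0) K := fun x hx => by
    simp only [hA x (hKR x hx)]
  refine ⟨A, hAw.trans (by omega), ?_, ?_⟩
  · exact MeasureTheory.IntegrableOn.congr_fun (hf.sub (integrable_bumpSum hp T)) heq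
      hK.measurableSet
  · refine (MeasureTheory.setIntegral_congr_fun hK.measurableSet fun x hx => ?_).trans_le hT
    exact congrArg abs (heq hx).symm
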